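/- Setting. Let $\mathcal S$ be a finite set of contexts with a probability distribution $P_S$, and let $\mathcal A=\{1,\dots,K\}$, $K\ge 1$, be the set of arms. A problem instance $\theta$ is drawn from a prior distribution. Under $\theta$, pulling arm $a$ in context $s$ gives a reward with law $P_R^\theta(\cdot\mid s,a)$; rewards have finite expectation (under the prior and $P_R^\theta$) for all $s,a$. Write $\mu_\theta(s,a)$ for the mean of $P_R^\theta(\cdot\mid s,a)$ and $a^*_\theta(s)\in\arg\max_a\mu_\theta(s,a)$. In each round $h=1,2,\dots$, $N$ agents have contexts $s_h^1,\dots,s_h^N$ that are i.i.d. from $P_S$ and independent of $\theta$ and of the past. A remote decision-maker, who sees the contexts and the history of all contexts, actions and rewards of the previous rounds, sends a message $m_h\in\{1,\dots,B\}$ drawn from a stochastic encoder $f_h$ applied to the history and $(s_h^1,\dots,s_h^N)$. The controller draws the actions $(a_h^1,\dots,a_h^N)\in\mathcal A^N$ from a stochastic decoder $g_h$ applied to $m_h$. Given $\theta$, the past, and the contexts and actions of round $h$, the rewards $r_h^n\sim P_R^\theta(\cdot\mid s_h^n,a_h^n)$, $n=1,\dots,N$, are independent. The rate of the scheme is $\frac1N\log_2B$,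 and its Bayesian system regret is $$\mathrm{BR}(H)=\mathbb E\Big[\sum_{h=1}^H\sum_{n=1}^N\mu_\theta(s_h^n,a^*_\theta(s_h^n))-\mu_\theta(s_h^n,a_h^n)\Big],$$ the expectation being over the instance, contexts, messages, actions and rewards. The regret is sub-linear if $\lim_{H\to\infty}\mathrm{BR}(H)/H=0$. Let $H(A^*)=H(A^*_\theta)$ be the entropy in bits of $A^*=a^*_\theta(S)$, $S\sim P_S$, under the instance $\theta$, that is, the entropy of the marginal $\pi^*(a)=\sum_sP_S(s)\pi^*(a\mid s)$ of the optimal policy $\pi^*$. Lemma. Let $R\in\mathbb R$. Suppose that, with positive probability under the prior (in particular, if almost surely), the optimal arm $a^*_\theta(s)$ is unique for every $s$ with $P_S(s)>0$ and $R<H(A^*_\theta)$. Then, for every number $N\ge1$ of agents and every number $B$ of messages, no sequence of encoders and decoders $(f_h,g_h)_{h\ge1}$ of rate $\frac1N\log_2B\le R$ has sub-linear Bayesian system regret. -/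

import Mathlib

open MeasureTheory ProbabilityTheory Filter Topology

noncomputable section

/-- A Bayesian contextual multi-armed bandit problem with finite context (state) set `S`, arms
`Fin K`, and set `Θ` of problem instances. The instance `θ` is drawn from `prior`, the contexts are
i.i.d. with law `stateLaw`, and under the instance `θ` the reward of arm `a` in context `s` has the
law `reward s a θ`. -/
structure ContextualBandit (S : Type*) (K : ℕ) (Θ : Type*) [MeasurableSpace Θ] where
  stateLaw : PMF S
  prior : Measure Θ
  reward : S → Fin K → Kernel Θ ℝ
  isProbabilityMeasure_prior : IsProbabilityMeasure prior
  isMarkovKernel_reward : ∀ s a, IsMarkovKernel (reward s a)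

/-- What is recorded in one round: the triples (context, action, reward) of the `N` agents. -/
abbrev Round (S : Type*) (K N : ℕ) : Type _ := Fin N → S × Fin K × ℝ

/-- What has been observed in the first `h` rounds. -/
abbrev History (S : Type*) (K N h : ℕ) : Type _ := Fin h → Round S K N

/-- A (stochastic) coding scheme for `N` agents with messages `Fin B`. In the round that follows
the first `h` ones, the encoder maps the history of these `h` rounds and the current contexts of
all agents to a random message; the decoder maps the message, and nothing else, to random actions
of all agents. -/
structure CodingScheme (S : Type*) [MeasurableSpace S] (K N B : ℕ) where
  encoder : (h : ℕ) → Kernel (History S K N h × (Fin N → S)) (Fin B)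
  decoder : ℕ → Kernel (Fin B) (Fin N → Fin K)
  isMarkovKernel_encoder : ∀ h, IsMarkovKernel (encoder h)
  isMarkovKernel_decoder : ∀ h, IsMarkovKernel (decoder h)

namespace CodingScheme

variable {S : Type*} [MeasurableSpace S] {K N B : ℕ}

/-- The rate of a scheme for `N` agents with `B` messages, in bits per agent and round. -/
def rate (_c : CodingScheme S K N B) : ℝ := Real.logb 2 B / N

/-- Given the history of the first `h` rounds and the contexts of all agents in the next round, the
law of the actions taken in that round. -/
def actionKernel (c : CodingScheme S K N B) (h : ℕ) :
    Kernel (History S K N h × (Fin N → S)) (Fin N → Fin K) :=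
  c.decoder h ∘ₖ c.encoder h

instance (c : CodingScheme S K N B) (h : ℕ) : IsMarkovKernel (c.actionKernel h) := by
  have := c.isMarkovKernel_encoder h
  have := c.isMarkovKernel_decoder h
  unfold actionKernel
  infer_instance

end CodingScheme

namespace ContextualBandit

variable {S : Type*} {K : ℕ} {Θ : Type*} [MeasurableSpace Θ]

instance (P : ContextualBandit S K Θ) : IsProbabilityMeasure P.prior :=
  P.isProbabilityMeasure_prior

instance (P : ContextualBandit S K Θ) (s : S) (a : Fin K) : IsMarkovKernel (P.reward s a) :=
  P.isMarkovKernel_reward s a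

/-- The mean reward `μ(s, a)` under the instance `θ`. -/
def meanReward (P : ContextualBandit S K Θ) (θ : Θ) (s : S) (a : Fin K) : ℝ :=
  ∫ r, r ∂(P.reward s a θ)

/-- The arm `a` maximizes the mean reward in context `s` under the instance `θ`. -/
def IsOptimalArm (P : ContextualBandit S K Θ) (θ : Θ) (s : S) (a : Fin K) : Prop :=
  ∀ b, P.meanReward θ s b ≤ P.meanReward θ s a

theorem exists_isOptimalArm [NeZero K] (P : ContextualBandit S K Θ) (θ : Θ) (s : S) :
    ∃ a, P.IsOptimalArm θ s a :=
  Finite.exists_max (P.meanReward θ s)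

/-- The optimal arm `a*(s)` under the instance `θ`. -/
def optimalArm [NeZero K] (P : ContextualBandit S K Θ) (θ : Θ) (s : S) : Fin K :=
  (P.exists_isOptimalArm θ s).choose

/-- The law of the optimal arm `A* = a*(S)` under the instance `θ`, for a random context `S`:
the marginal `π*(a) = ∑ s, P_S(s) π*(a | s)` of the optimal policy. -/
def optimalArmLaw [NeZero K] (P : ContextualBandit S K Θ) (θ : Θ) : PMF (Fin K) :=
  P.stateLaw.map (P.optimalArm θ)

/-- The entropy `H(A*)`, in bits, of the optimal arm under the instance `θ`. -/
def optimalArmEntropy [NeZero K] (P : ContextualBandit S K Θ) (θ : Θ) : ℝ :=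
  -∑ a, (P.optimalArmLaw θ a).toReal * Real.logb 2 (P.optimalArmLaw θ a).toReal

theorem measurable_snoc [MeasurableSpace S] {N : ℕ} (H : ℕ) :
    Measurable fun y : History S K N H × Round S K N =>
      (Fin.snoc (α := fun _ => Round S K N) y.1 y.2 : History S K N (H + 1)) := by
  refine measurable_pi_lambda _ fun i => ?_
  refine Fin.lastCases ?_ (fun j => ?_) i
  · simpa using measurable_snd
  · simpa [Function.comp_def] using
      (measurable_pi_apply (X := fun _ : Fin H => Round S K N) j).comp
        (measurable_fst (β := Round S K N))

variable [MeasurableSpace S] [Countable S] [MeasurableSingletonClass S]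

/-- Given the instance and the contexts and actions of all agents, the rewards are independent, and
that of agent `n` has the law prescribed by its own context and action. -/
def rewardKernel (P : ContextualBandit S K Θ) (N : ℕ) :
    Kernel (Θ × ((Fin N → S) × (Fin N → Fin K))) (Fin N → ℝ) where
  toFun x := Measure.pi fun n => P.reward (x.2.1 n) (x.2.2 n) x.1
  measurable' := by
    refine measurable_from_prod_countable_left fun y => ?_
    refine Measurable.measure_of_isPiSystem_of_isProbabilityMeasure
      generateFrom_pi.symm isPiSystem_pi ?_
    rintro _ ⟨t, ht, rfl⟩
    simp only [Measure.pi_pi]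
    exact Finset.measurable_prod _ fun n _ =>
      Kernel.measurable_coe _ (ht n (Set.mem_univ n))

instance (P : ContextualBandit S K Θ) (N : ℕ) : IsMarkovKernel (P.rewardKernel N) :=
  ⟨fun x => by
    change IsProbabilityMeasure (Measure.pi fun n => P.reward (x.2.1 n) (x.2.2 n) x.1)
    infer_instance⟩

variable {N B : ℕ}

/-- Given the history of the first `h` rounds, the joint law of the contexts (i.i.d. across the
agents and independent of the past) and of the actions in the next round. -/
def contextActionKernel (P : ContextualBandit S K Θ) (c : CodingScheme S K N B) (h : ℕ) :
    Kernel (History S K N h) ((Fin N → S) × (Fin N → Fin K)) :=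
  Kernel.const _ (Measure.pi fun _ : Fin N => P.stateLaw.toMeasure) ⊗ₖ c.actionKernel h

instance (P : ContextualBandit S K Θ) (c : CodingScheme S K N B) (h : ℕ) :
    IsMarkovKernel (P.contextActionKernel c h) := by
  unfold contextActionKernel
  infer_instance

/-- Given the instance and the history of the first `h` rounds, the law of the next round. -/
def roundKernel (P : ContextualBandit S K Θ) (c : CodingScheme S K N B) (h : ℕ) :
    Kernel (Θ × History S K N h) (Round S K N) :=
  ((P.contextActionKernel c h).comap Prod.snd measurable_snd ⊗ₖ
    (P.rewardKernel N).comap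
      (fun x : (Θ × History S K N h) × ((Fin N → S) × (Fin N → Fin K)) => (x.1.1, x.2))
      (by fun_prop)).map
    (fun y n => (y.1.1 n, y.1.2 n, y.2 n))

instance (P : ContextualBandit S K Θ) (c : CodingScheme S K N B) (h : ℕ) :
    IsMarkovKernel (P.roundKernel c h) := by
  unfold roundKernel
  exact Kernel.IsMarkovKernel.map _ (by fun_prop)

/-- Given the instance, the law of the history of the first `H` rounds. -/
def historyKernel (P : ContextualBandit S K Θ) (c : CodingScheme S K N B) :
    (H : ℕ) → Kernel Θ (History S K N H)
  | 0 => Kernel.const _ (Measure.dirac Fin.elim0)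
  | H + 1 => (historyKernel P c H ⊗ₖ P.roundKernel c H).map
      (fun y => Fin.snoc (α := fun _ => Round S K N) y.1 y.2)

instance isMarkovKernel_historyKernel (P : ContextualBandit S K Θ) (c : CodingScheme S K N B)
    (H : ℕ) : IsMarkovKernel (P.historyKernel c H) := by
  induction H with
  | zero => unfold historyKernel; infer_instance
  | succ H ih => unfold historyKernel; exact Kernel.IsMarkovKernel.map _ (measurable_snoc H)

/-- The Bayesian system regret over `H` rounds of a coding scheme for `N` agents: the expectation,
over instances, contexts, messages, actions and rewards, of
`∑ h < H, ∑ n, (μ(s_h^n, a*(s_h^n)) - μ(s_h^n, a_h^n))`. -/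
def bayesRegret [NeZero K] (P : ContextualBandit S K Θ) (c : CodingScheme S K N B) (H : ℕ) : ℝ :=
  ∫ x : Θ × History S K N H,
    ∑ h : Fin H, ∑ n : Fin N,
      (P.meanReward x.1 (x.2 h n).1 (P.optimalArm x.1 (x.2 h n).1)
        - P.meanReward x.1 (x.2 h n).1 (x.2 h n).2.1)
    ∂(P.prior ⊗ₘ P.historyKernel c H)

/-- The regret is sub-linear in the number of rounds. -/
def HasSublinearRegret [NeZero K] (P : ContextualBandit S K Θ) (c : CodingScheme S K N B) : Prop :=
  Tendsto (fun H : ℕ => P.bayesRegret c H / H) atTop (𝓝 0)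

end ContextualBandit

end

/-! The obstruction is a counting argument within a single round, and learning cannot remove it. Fix
an instance `θ` with unique optimal arms and rate below `H(A*)`. Entropy is at most the log of the
support size, so `B < k ^ N`, where `k` is the number of arms that are optimal in some possible
context (`messages_lt_card_pow`). Each of the `k ^ N` vectors of such arms is the only optimal
response to some context vector of positive probability. The decoder sees only the message, so the
probabilities of answering these vectors correctly sum to at most `B`; among any `B + 1` of them,
one is missed with probability at least `1 / (B + 1)` (`exists_actionKernel_le`). A miss costs at
least the smallest positive gap, so every round costs at least some `ε(θ) > 0`, whatever the past
(`exists_pos_le_roundRegret`).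

The average regret given `θ` is then at least `ε(θ)` at every horizon. Sub-linear Bayesian regret
would force its infimum over horizons to vanish for almost every `θ`, a contradiction. -/

noncomputable section

/-! ### Entropy bound and finite minima -/

/-- The entropy of a finitely supported law is at most the logarithm of the size of its support. -/
theorem entropy_le_logb_card_support {ι : Type*} [Fintype ι] [DecidableEq ι] (p : ι → ℝ)
    (hp : ∀ i, 0 ≤ p i) (hsum : ∑ i, p i = 1) :
    -∑ i, p i * Real.logb 2 (p i) ≤ Real.logb 2 (Finset.univ.filter fun i => p i ≠ 0).card := by
  set T := Finset.univ.filter fun i => p i ≠ 0 with hT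
  have hsumT : ∑ i ∈ T, p i = 1 := by
    rw [hT, Finset.sum_filter_ne_zero, hsum]
  have hne : T.Nonempty := by
    by_contra h
    rw [Finset.not_nonempty_iff_eq_empty] at h
    simp [h] at hsumT
  have hk : (0 : ℝ) < T.card := by exact_mod_cast hne.card_pos
  -- This is `log x ≤ x - 1` at `x = 1 / (p i * |T|)`, multiplied by `p i`; in the sum over `T` the
  -- first two terms cancel.
  have key : ∀ i ∈ T, -(p i * Real.log (p i)) ≤ 1 / T.card - p i + p i * Real.log T.card := by
    intro i hi
    have hpi : 0 < p i := lt_of_le_of_ne (hp i) (Ne.symm (by simpa [hT] using hi))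
    have h := Real.log_le_sub_one_of_pos (x := 1 / (p i * T.card)) (by positivity)
    rw [one_div, Real.log_inv, Real.log_mul hpi.ne' hk.ne'] at h
    have h' := mul_le_mul_of_nonneg_left h hpi.le
    have e : p i * ((p i * (T.card : ℝ))⁻¹ - 1) = 1 / T.card - p i := by field_simp
    rw [e] at h'
    linarith
  have hlog : -∑ i, p i * Real.log (p i) ≤ Real.log T.card := by
    have e : ∑ i, p i * Real.log (p i) = ∑ i ∈ T, p i * Real.log (p i) := by
      rw [hT, Finset.sum_filter]
      exact Finset.sum_congr rfl fun i _ => by by_cases h : p i = 0 <;> simp [h]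
    rw [e, ← Finset.sum_neg_distrib]
    refine (Finset.sum_le_sum key).trans_eq ?_
    rw [Finset.sum_add_distrib, Finset.sum_sub_distrib, ← Finset.sum_mul, hsumT,
      Finset.sum_const, nsmul_eq_mul]
    field_simp
    ring
  have h2 : (0 : ℝ) < Real.log 2 := Real.log_pos one_lt_two
  simp only [Real.logb]
  rw [le_div_iff₀ h2]
  refine le_of_eq_of_le ?_ hlog
  rw [neg_mul, Finset.sum_mul]
  congr 1
  exact Finset.sum_congr rfl fun i _ => by field_simp

theorem exists_pos_forall_le {ι : Type*} [Finite ι] (p : ι → Prop) (f : ι → ℝ)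
    (hf : ∀ i, p i → 0 < f i) : ∃ δ > 0, ∀ i, p i → δ ≤ f i := by
  classical
  have := Fintype.ofFinite ι
  by_cases h : (Finset.univ.filter p).Nonempty
  · obtain ⟨i, hi, hmin⟩ := Finset.exists_min_image _ f h
    exact ⟨f i, hf i (by simpa using hi), fun j hj => hmin j (by simpa using hj)⟩
  · refine ⟨1, one_pos, fun i hi => absurd ⟨i, by simpa using hi⟩ h⟩

/-! ### Counting messages -/

namespace CodingScheme

variable {S : Type*} [MeasurableSpace S] {K N B : ℕ}

/-- The bound is free of `x`, so it can be summed over `a` even when the contexts vary with `a`. -/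
theorem actionKernel_apply_le (c : CodingScheme S K N B) (h : ℕ)
    (x : History S K N h × (Fin N → S)) (a : Fin N → Fin K) :
    c.actionKernel h x {a} ≤ ∑ m, c.decoder h m {a} := by
  have := c.isMarkovKernel_encoder h
  rw [actionKernel, Kernel.comp_apply' _ _ _ (measurableSet_singleton a)]
  calc ∫⁻ m, c.decoder h m {a} ∂c.encoder h x
      ≤ ∫⁻ _, ∑ m, c.decoder h m {a} ∂c.encoder h x :=
        lintegral_mono fun m =>
          Finset.single_le_sum (f := fun m => c.decoder h m {a}) (fun _ _ => zero_le)
            (Finset.mem_univ m)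
    _ = _ := by simp

/-- If more action vectors than messages are asked for, one of them is missed with probability at
least `1 / (B + 1)`. -/
theorem exists_actionKernel_le (c : CodingScheme S K N B) (h : ℕ) (T : Finset (Fin N → Fin K))
    (hT : B < T.card) (x : (Fin N → Fin K) → History S K N h × (Fin N → S)) :
    ∃ a ∈ T, ((B + 1 : ℕ) : ENNReal)⁻¹ ≤ c.actionKernel h (x a) {a}ᶜ := by
  have := c.isMarkovKernel_decoder h
  by_contra! hcon
  -- Keeping exactly `B + 1` vectors makes the bound depend on `B` alone.
  obtain ⟨U, hUT, hU⟩ := Finset.exists_subset_card_eq (Nat.succ_le_of_lt hT)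
  have hsumU : ∑ a ∈ U, c.actionKernel h (x a) {a} ≤ B :=
    calc ∑ a ∈ U, c.actionKernel h (x a) {a}
        ≤ ∑ a ∈ U, ∑ m, c.decoder h m {a} :=
          Finset.sum_le_sum fun a _ => c.actionKernel_apply_le h _ a
      _ = ∑ m, ∑ a ∈ U, c.decoder h m {a} := Finset.sum_comm
      _ ≤ ∑ _m : Fin B, 1 := Finset.sum_le_sum fun m _ => by
          rw [sum_measure_singleton]
          exact prob_le_one
      _ = B := by simp
  have hne : U.Nonempty := by
    rw [← Finset.card_pos, hU]
    exact Nat.succ_pos _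
  have hlt : ∑ a ∈ U, c.actionKernel h (x a) {a}ᶜ < 1 := by
    calc _ < ∑ a ∈ U, ((B + 1 : ℕ) : ENNReal)⁻¹ := by
            refine ENNReal.sum_lt_sum_of_nonempty hne fun a ha => hcon a (hUT ha)
      _ = 1 := by
        rw [Finset.sum_const, hU, nsmul_eq_mul]
        exact ENNReal.mul_inv_cancel (by simp) (ENNReal.natCast_ne_top _)
  -- Hits and misses total `B + 1`, yet hits are at most `B` and misses less than `1`.
  have heq : ∑ a ∈ U, c.actionKernel h (x a) {a}ᶜ + ∑ a ∈ U, c.actionKernel h (x a) {a}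
      = 1 + B := by
    rw [← Finset.sum_add_distrib, Finset.sum_congr rfl (g := fun _ => (1 : ENNReal))]
    · simp [hU, add_comm]
    · intro a _
      rw [add_comm, prob_add_prob_compl (measurableSet_singleton a)]
  exact (ENNReal.add_lt_add_of_lt_of_le (ne_top_of_le_ne_top (ENNReal.natCast_ne_top _) hsumU)
    hlt hsumU).ne heq

end CodingScheme

/-! ### Gaps and optimal arms -/

namespace ContextualBandit

variable {S : Type*} {K : ℕ} {Θ : Type*} [MeasurableSpace Θ]

theorem measurable_meanReward (P : ContextualBandit S K Θ) (s : S) (a : Fin K) :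
    Measurable fun θ => P.meanReward θ s a :=
  (StronglyMeasurable.integral_kernel (κ := P.reward s a) stronglyMeasurable_id).measurable

theorem integrable_meanReward (P : ContextualBandit S K Θ) (s : S) (a : Fin K)
    (h : Integrable (fun r : ℝ => r) (P.reward s a ∘ₘ P.prior)) :
    Integrable (fun θ => P.meanReward θ s a) P.prior :=
  (Measure.integrable_integral_norm_of_integrable_comp h).mono'
    (P.measurable_meanReward s a).aestronglyMeasurable
    (Eventually.of_forall fun _ => norm_integral_le_integral_norm _)

variable [NeZero K]

/-- The suboptimality gap of the arm `a` in the context `s` under the instance `θ`. -/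
def gap (P : ContextualBandit S K Θ) (θ : Θ) (s : S) (a : Fin K) : ℝ :=
  P.meanReward θ s (P.optimalArm θ s) - P.meanReward θ s a

theorem isOptimalArm_optimalArm (P : ContextualBandit S K Θ) (θ : Θ) (s : S) :
    P.IsOptimalArm θ s (P.optimalArm θ s) :=
  (P.exists_isOptimalArm θ s).choose_spec

theorem gap_nonneg (P : ContextualBandit S K Θ) (θ : Θ) (s : S) (a : Fin K) :
    0 ≤ P.gap θ s a :=
  sub_nonneg.2 (P.isOptimalArm_optimalArm θ s a)

theorem gap_pos (P : ContextualBandit S K Θ) {θ : Θ} {s : S} (h : ∃! a, P.IsOptimalArm θ s a)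
    {a : Fin K} (ha : a ≠ P.optimalArm θ s) : 0 < P.gap θ s a := by
  refine lt_of_le_of_ne (P.gap_nonneg θ s a) fun h0 => ha (h.unique ?_ (P.isOptimalArm_optimalArm θ s))
  intro b
  rw [← sub_eq_zero.1 h0.symm]
  exact P.isOptimalArm_optimalArm θ s b

/-- The optimal arm is picked by choice, with no measurability in `θ`; its value, a finite maximum,
is measurable. -/
theorem meanReward_optimalArm (P : ContextualBandit S K Θ) (θ : Θ) (s : S) :
    P.meanReward θ s (P.optimalArm θ s)
      = Finset.univ.sup' Finset.univ_nonempty (P.meanReward θ s) :=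
  le_antisymm (Finset.le_sup' _ (Finset.mem_univ _))
    (Finset.sup'_le _ _ fun b _ => P.isOptimalArm_optimalArm θ s b)

theorem measurable_gap (P : ContextualBandit S K Θ) (s : S) (a : Fin K) :
    Measurable fun θ => P.gap θ s a := by
  simp only [gap, meanReward_optimalArm]
  refine Measurable.sub ?_ (P.measurable_meanReward s a)
  have := Finset.measurable_sup' (s := Finset.univ) Finset.univ_nonempty
    (f := fun a θ => P.meanReward θ s a) fun a _ => P.measurable_meanReward s a
  convert this using 1
  ext θ
  simp

theorem gap_le (P : ContextualBandit S K Θ) (θ : Θ) (s : S) (a : Fin K) :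
    P.gap θ s a ≤ 2 * ∑ b, |P.meanReward θ s b| := by
  have h : ∀ b, |P.meanReward θ s b| ≤ ∑ b, |P.meanReward θ s b| := fun b =>
    Finset.single_le_sum (f := fun b => |P.meanReward θ s b|) (fun _ _ => abs_nonneg _)
      (Finset.mem_univ b)
  have h1 := (abs_le.1 (h (P.optimalArm θ s))).2
  have h2 := (abs_le.1 (h a)).1
  unfold gap
  linarith

theorem support_optimalArmLaw (P : ContextualBandit S K Θ) (θ : Θ) (a : Fin K) :
    (P.optimalArmLaw θ a).toReal ≠ 0 ↔ ∃ s, P.stateLaw s ≠ 0 ∧ P.optimalArm θ s = a := by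
  rw [ENNReal.toReal_ne_zero, and_iff_left (PMF.apply_ne_top _ _), ← PMF.mem_support_iff,
    optimalArmLaw, PMF.mem_support_map_iff]
  simp [PMF.mem_support_iff]

theorem optimalArmEntropy_le (P : ContextualBandit S K Θ) (θ : Θ) :
    P.optimalArmEntropy θ ≤
      Real.logb 2 (Finset.univ.filter fun a => (P.optimalArmLaw θ a).toReal ≠ 0).card := by
  refine entropy_le_logb_card_support (fun a => (P.optimalArmLaw θ a).toReal)
    (fun a => ENNReal.toReal_nonneg) ?_
  rw [← ENNReal.toReal_sum fun a _ => PMF.apply_ne_top _ _, ← tsum_fintype (L := .unconditional _), PMF.tsum_coe,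
    ENNReal.toReal_one]

variable [MeasurableSpace S] {N B : ℕ}

/-- A scheme whose rate is below the entropy of the optimal arm has fewer messages than there are
vectors of optimal arms. -/
theorem messages_lt_card_pow (P : ContextualBandit S K Θ) (c : CodingScheme S K N B) (hN : 1 ≤ N)
    {θ : Θ} (h : c.rate < P.optimalArmEntropy θ) :
    B < (Finset.univ.filter fun a => (P.optimalArmLaw θ a).toReal ≠ 0).card ^ N := by
  have h1 := h.trans_le (P.optimalArmEntropy_le θ)
  set k := (Finset.univ.filter fun a => (P.optimalArmLaw θ a).toReal ≠ 0).card with hk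
  have hkpos : 0 < k := by
    obtain ⟨a, ha⟩ := (P.optimalArmLaw θ).support_nonempty
    refine Finset.card_pos.2 ⟨a, ?_⟩
    simpa [ENNReal.toReal_eq_zero_iff, PMF.apply_ne_top] using ha
  -- Strict monotonicity of the logarithm needs `B > 0`.
  rcases Nat.eq_zero_or_pos B with rfl | hB
  · positivity
  have hN' : (0 : ℝ) < N := by exact_mod_cast hN
  rw [CodingScheme.rate, div_lt_iff₀ hN', mul_comm, ← Real.logb_pow] at h1
  have := (Real.logb_lt_logb_iff one_lt_two (by exact_mod_cast hB) (by positivity)).1 h1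
  exact_mod_cast this

variable [MeasurableSingletonClass S]

/-! ### Regret round by round -/

section Countable

variable [Countable S]

theorem measurable_roundRegret (P : ContextualBandit S K Θ) (θ : Θ) :
    Measurable fun r : Round S K N => ∑ n, ENNReal.ofReal (P.gap θ (r n).1 (r n).2.1) := by
  have h : Measurable fun y : S × Fin K => ENNReal.ofReal (P.gap θ y.1 y.2) :=
    measurable_of_countable _
  exact Finset.measurable_sum _ fun n _ =>
    h.comp (g := fun y : S × Fin K => ENNReal.ofReal (P.gap θ y.1 y.2))
      (f := fun r : Round S K N => ((r n).1, (r n).2.1)) (by fun_prop)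

theorem measurable_regret (P : ContextualBandit S K Θ) (H : ℕ) :
    Measurable fun x : Θ × History S K N H => ∑ h, ∑ n, P.gap x.1 (x.2 h n).1 (x.2 h n).2.1 := by
  have h : Measurable fun y : Θ × (S × Fin K) => P.gap y.1 y.2.1 y.2.2 :=
    measurable_from_prod_countable_left fun y => P.measurable_gap y.1 y.2
  exact Finset.measurable_sum _ fun i _ => Finset.measurable_sum _ fun n _ =>
    h.comp (g := fun y : Θ × (S × Fin K) => P.gap y.1 y.2.1 y.2.2)
      (f := fun x : Θ × History S K N H => (x.1, (x.2 i n).1, (x.2 i n).2.1)) (by fun_prop)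

/-- The expected regret of one round is that of its contexts and actions. -/
theorem lintegral_roundKernel (P : ContextualBandit S K Θ) (c : CodingScheme S K N B) (h : ℕ)
    (θ : Θ) (y : History S K N h) :
    ∫⁻ r, ∑ n, ENNReal.ofReal (P.gap θ (r n).1 (r n).2.1) ∂P.roundKernel c h (θ, y)
      = ∫⁻ s, ∫⁻ a, ∑ n, ENNReal.ofReal (P.gap θ (s n) (a n)) ∂c.actionKernel h (y, s)
          ∂(Measure.pi fun _ : Fin N => P.stateLaw.toMeasure) := by
  rw [roundKernel, Kernel.lintegral_map _ (by fun_prop) _ (P.measurable_roundRegret θ),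
    Kernel.lintegral_compProd]
  · simp only [lintegral_const, measure_univ, mul_one]
    rw [Kernel.comap_apply, contextActionKernel, Kernel.lintegral_compProd]
    · simp
    · exact measurable_of_countable _
  · exact (P.measurable_roundRegret θ).comp (by fun_prop)

theorem lintegral_historyKernel_succ (P : ContextualBandit S K Θ) (c : CodingScheme S K N B)
    (H : ℕ) (θ : Θ) :
    ∫⁻ y, ∑ h, ∑ n, ENNReal.ofReal (P.gap θ (y h n).1 (y h n).2.1) ∂P.historyKernel c (H + 1) θ
      = ∫⁻ y, ((∑ h, ∑ n, ENNReal.ofReal (P.gap θ (y h n).1 (y h n).2.1)) +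
          ∫⁻ r, ∑ n, ENNReal.ofReal (P.gap θ (r n).1 (r n).2.1) ∂P.roundKernel c H (θ, y))
          ∂P.historyKernel c H θ := by
  have hm : ∀ H, Measurable fun y : History S K N H =>
      ∑ h, ∑ n, ENNReal.ofReal (P.gap θ (y h n).1 (y h n).2.1) := fun H =>
    Finset.measurable_sum _ fun h _ => (P.measurable_roundRegret θ).comp (measurable_pi_apply h)
  rw [historyKernel, Kernel.lintegral_map _ (measurable_snoc H) _ (hm _)]
  refine (Kernel.lintegral_compProd _ _ _ ((hm _).comp (measurable_snoc H))).trans ?_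
  simp only [Function.comp_apply]
  refine lintegral_congr fun y => ?_
  simp only [Fin.sum_univ_castSucc, Fin.snoc_castSucc, Fin.snoc_last]
  rw [lintegral_add_left measurable_const]
  simp

/-- A lower bound for the regret of each round, uniform in the past, adds up over the rounds. -/
theorem le_lintegral_historyKernel (P : ContextualBandit S K Θ) (c : CodingScheme S K N B) (θ : Θ)
    (ε : ENNReal)
    (hε : ∀ h (y : History S K N h),
      ε ≤ ∫⁻ r, ∑ n, ENNReal.ofReal (P.gap θ (r n).1 (r n).2.1) ∂P.roundKernel c h (θ, y))
    (H : ℕ) :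
    H * ε ≤ ∫⁻ y, ∑ h, ∑ n, ENNReal.ofReal (P.gap θ (y h n).1 (y h n).2.1)
      ∂P.historyKernel c H θ := by
  induction H with
  | zero => simp
  | succ H ih =>
    rw [lintegral_historyKernel_succ]
    refine le_trans ?_ (lintegral_mono fun y => add_le_add_right (hε H y) _)
    rw [lintegral_add_right _ measurable_const]
    simp only [lintegral_const, measure_univ, mul_one]
    push_cast
    rw [add_mul, one_mul]
    gcongr

end Countable

/-! ### Lower bound for one round -/

variable [Fintype S]

/-- If the optimal arms are unique and the rate is below their entropy, the expected regret of every
round is bounded below, uniformly in the past. -/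
theorem exists_pos_le_roundRegret (P : ContextualBandit S K Θ) (c : CodingScheme S K N B)
    (hN : 1 ≤ N) {θ : Θ} (huniq : ∀ s, P.stateLaw s ≠ 0 → ∃! a, P.IsOptimalArm θ s a)
    (hrate : c.rate < P.optimalArmEntropy θ) :
    ∃ ε : ENNReal, 0 < ε ∧ ∀ h (y : History S K N h),
      ε ≤ ∫⁻ r, ∑ n, ENNReal.ofReal (P.gap θ (r n).1 (r n).2.1) ∂P.roundKernel c h (θ, y) := by
  classical
  obtain ⟨δ, hδ, hgap⟩ := exists_pos_forall_le
    (fun x : S × Fin K => P.stateLaw x.1 ≠ 0 ∧ x.2 ≠ P.optimalArm θ x.1)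
    (fun x => P.gap θ x.1 x.2) fun x hx => P.gap_pos (huniq _ hx.1) hx.2
  obtain ⟨p, hp, hstate⟩ := exists_pos_forall_le (fun s : S => P.stateLaw s ≠ 0)
    (fun s => (P.stateLaw s).toReal)
    fun s hs => ENNReal.toReal_pos hs (PMF.apply_ne_top _ _)
  set A := Finset.univ.filter fun a => (P.optimalArmLaw θ a).toReal ≠ 0 with hA
  set T : Finset (Fin N → Fin K) := Fintype.piFinset fun _ => A with hT
  have hcard : B < T.card := by
    have := P.messages_lt_card_pow c hN hrate
    simpa [hT, ← hA] using this
  have hctx : ∀ a : Fin N → Fin K, ∃ s : Fin N → S,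
      a ∈ T → ∀ n, P.stateLaw (s n) ≠ 0 ∧ P.optimalArm θ (s n) = a n := by
    intro a
    by_cases ha : a ∈ T
    · have : ∀ n, ∃ s, P.stateLaw s ≠ 0 ∧ P.optimalArm θ s = a n := fun n =>
        (P.support_optimalArmLaw θ (a n)).1 (Finset.mem_filter.1 (Fintype.mem_piFinset.1 ha n)).2
      choose s hs using this
      exact ⟨s, fun _ => hs⟩
    · exact ⟨fun _ => P.stateLaw.support_nonempty.some, fun h => absurd h ha⟩
  choose s hs using hctx
  -- Least gap, times miss probability, times least probability of a possible context vector. The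
  -- missed vector may depend on the past; this constant does not.
  refine ⟨ENNReal.ofReal δ * ((B + 1 : ℕ) : ENNReal)⁻¹ * ENNReal.ofReal p ^ N, ?_, fun h y => ?_⟩
  · refine ENNReal.mul_pos (mul_ne_zero ?_ ?_) (pow_ne_zero _ ?_)
    · simpa using hδ
    · exact ENNReal.inv_ne_zero.2 (ENNReal.natCast_ne_top _)
    · simpa using hp
  obtain ⟨a, haT, ha⟩ := c.exists_actionKernel_le h T hcard fun a => (y, s a)
  rw [lintegral_roundKernel]
  have hinner : ENNReal.ofReal δ * ((B + 1 : ℕ) : ENNReal)⁻¹ ≤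
      ∫⁻ b, ∑ n, ENNReal.ofReal (P.gap θ (s a n) (b n)) ∂c.actionKernel h (y, s a) := by
    calc ENNReal.ofReal δ * ((B + 1 : ℕ) : ENNReal)⁻¹
        ≤ ENNReal.ofReal δ * c.actionKernel h (y, s a) {a}ᶜ := by gcongr
      _ = ∫⁻ _ in {a}ᶜ, ENNReal.ofReal δ ∂c.actionKernel h (y, s a) := by simp
      _ ≤ ∫⁻ b in {a}ᶜ, ∑ n, ENNReal.ofReal (P.gap θ (s a n) (b n))
            ∂c.actionKernel h (y, s a) := by
          refine setLIntegral_mono (measurable_of_countable _) fun b hb => ?_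
          -- Some agent `n` departs from `a n`, the unique optimal arm in its context.
          obtain ⟨n, hn⟩ := Function.ne_iff.1 hb
          refine le_trans (ENNReal.ofReal_le_ofReal (hgap (s a n, b n) ⟨(hs a haT n).1, ?_⟩))
            (Finset.single_le_sum (f := fun n => ENNReal.ofReal (P.gap θ (s a n) (b n)))
              (fun _ _ => zero_le) (Finset.mem_univ n))
          rw [(hs a haT n).2]
          exact hn
      _ ≤ _ := setLIntegral_le_lintegral _ _
  have hprob : ENNReal.ofReal p ^ N ≤
      (Measure.pi fun _ : Fin N => P.stateLaw.toMeasure) {s a} := by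
    rw [Measure.pi_singleton]
    calc ENNReal.ofReal p ^ N = ∏ _n : Fin N, ENNReal.ofReal p := by simp
      _ ≤ _ := Finset.prod_le_prod' fun n _ => by
          rw [PMF.toMeasure_apply_singleton _ _ (measurableSet_singleton _)]
          exact ENNReal.ofReal_le_of_le_toReal (hstate _ (hs a haT n).1)
  refine (mul_le_mul' hinner hprob).trans ?_
  rw [← lintegral_singleton (fun t => ∫⁻ b, ∑ n, ENNReal.ofReal (P.gap θ (t n) (b n))
    ∂c.actionKernel h (y, t))]
  exact setLIntegral_le_lintegral _ _

/-! ### Averaging over the prior -/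

theorem integrable_regret (P : ContextualBandit S K Θ) (c : CodingScheme S K N B)
    (hint : ∀ s a, Integrable (fun r : ℝ => r) (P.reward s a ∘ₘ P.prior)) (H : ℕ) :
    Integrable (fun x : Θ × History S K N H => ∑ h, ∑ n, P.gap x.1 (x.2 h n).1 (x.2 h n).2.1)
      (P.prior ⊗ₘ P.historyKernel c H) := by
  have hdom : Integrable (fun θ => 2 * ∑ s, ∑ b, |P.meanReward θ s b|) P.prior :=
    (integrable_finsetSum _ fun s _ => integrable_finsetSum _ fun b _ =>
      (P.integrable_meanReward s b (hint s b)).abs).const_mul 2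
  -- The dominating function depends on `θ` only, and the prior is the first marginal of the joint
  -- law.
  rw [← Measure.fst_compProd P.prior (P.historyKernel c H), Measure.fst] at hdom
  have hdom' := hdom.comp_measurable measurable_fst
  refine Integrable.mono' (g := fun x => ∑ _h : Fin H, ∑ _n : Fin N,
      2 * ∑ s, ∑ b, |P.meanReward x.1 s b|)
    (integrable_finsetSum _ fun _ _ => integrable_finsetSum _ fun _ _ => hdom')
    (P.measurable_regret H).aestronglyMeasurable (Eventually.of_forall fun x => ?_)
  rw [Real.norm_of_nonneg (Finset.sum_nonneg fun h _ => Finset.sum_nonneg fun n _ =>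
    P.gap_nonneg _ _ _)]
  refine Finset.sum_le_sum fun h _ => Finset.sum_le_sum fun n _ => (P.gap_le _ _ _).trans ?_
  gcongr
  exact Finset.single_le_sum (f := fun s => ∑ b, |P.meanReward x.1 s b|)
    (fun _ _ => Finset.sum_nonneg fun _ _ => abs_nonneg _) (Finset.mem_univ _)

theorem measurable_ofReal_regret (P : ContextualBandit S K Θ) (H : ℕ) :
    Measurable fun x : Θ × History S K N H =>
      ∑ h, ∑ n, ENNReal.ofReal (P.gap x.1 (x.2 h n).1 (x.2 h n).2.1) := by
  convert (P.measurable_regret (N := N) H).ennreal_ofReal using 2 with x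
  rw [ENNReal.ofReal_sum_of_nonneg fun h _ => Finset.sum_nonneg fun n _ => P.gap_nonneg _ _ _]
  exact Finset.sum_congr rfl fun h _ =>
    (ENNReal.ofReal_sum_of_nonneg fun n _ => P.gap_nonneg _ _ _).symm

/-- Integrability is essential: without it the Bochner integral defaults to `0` and would say
nothing about the regret. -/
theorem ofReal_bayesRegret (P : ContextualBandit S K Θ) (c : CodingScheme S K N B)
    (hint : ∀ s a, Integrable (fun r : ℝ => r) (P.reward s a ∘ₘ P.prior)) (H : ℕ) :
    ENNReal.ofReal (P.bayesRegret c H) =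
      ∫⁻ θ, ∫⁻ y, ∑ h, ∑ n, ENNReal.ofReal (P.gap θ (y h n).1 (y h n).2.1)
        ∂P.historyKernel c H θ ∂P.prior := by
  rw [← Measure.lintegral_compProd (P.measurable_ofReal_regret H)]
  refine (ofReal_integral_eq_lintegral_ofReal (P.integrable_regret c hint H)
    (Eventually.of_forall fun x => Finset.sum_nonneg fun h _ => Finset.sum_nonneg fun n _ =>
      P.gap_nonneg _ _ _)).trans (lintegral_congr fun x => ?_)
  rw [ENNReal.ofReal_sum_of_nonneg fun h _ => Finset.sum_nonneg fun n _ => P.gap_nonneg _ _ _]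
  exact Finset.sum_congr rfl fun h _ =>
    ENNReal.ofReal_sum_of_nonneg fun n _ => P.gap_nonneg _ _ _

end ContextualBandit

end

/-- If, with positive prior probability, the optimal arms are unique and `R < H(A*)`, then no coding
scheme, for any number of agents, of rate at most `R` has sub-linear Bayesian system regret. -/
theorem lemma2 {S : Type*} [Fintype S] [MeasurableSpace S] [MeasurableSingletonClass S]
    {K : ℕ} [NeZero K] {Θ : Type*} [MeasurableSpace Θ]
    (P : ContextualBandit S K Θ)
    (hint : ∀ s a, Integrable (fun r : ℝ => r) (P.reward s a ∘ₘ P.prior))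
    (R : ℝ)
    (hR : ∃ᵐ θ ∂P.prior,
      (∀ s, P.stateLaw s ≠ 0 → ∃! a, P.IsOptimalArm θ s a) ∧ R < P.optimalArmEntropy θ)
    (N : ℕ) (hN : 1 ≤ N) (B : ℕ) (c : CodingScheme S K N B) (hrate : c.rate ≤ R) :
    ¬ P.HasSublinearRegret c := by
  intro hsub
  -- The shift to `H + 1` excludes `0 / 0 = 0`, which would make the infimum below trivially zero.
  set F : ℕ → Θ → ENNReal := fun H θ =>
    (∫⁻ y, ∑ h, ∑ n, ENNReal.ofReal (P.gap θ (y h n).1 (y h n).2.1)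
      ∂P.historyKernel c (H + 1) θ) / ((H + 1 : ℕ) : ENNReal) with hF
  have hFm : ∀ H, Measurable (F H) := fun H =>
    (Measurable.lintegral_kernel_prod_right' (κ := P.historyKernel c (H + 1))
      (P.measurable_ofReal_regret (H + 1))).div_const _
  have hFint : ∀ H, ∫⁻ θ, F H θ ∂P.prior
      = ENNReal.ofReal (P.bayesRegret c (H + 1) / ((H + 1 : ℕ) : ℝ)) := by
    intro H
    rw [ENNReal.ofReal_div_of_pos (by positivity), P.ofReal_bayesRegret c hint,
      ENNReal.ofReal_natCast]
    simp only [hF, div_eq_mul_inv]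
    rw [lintegral_mul_const' _ _ (ENNReal.inv_ne_top.2 (by simp))]
  have hlim : Tendsto (fun H => ∫⁻ θ, F H θ ∂P.prior) atTop (𝓝 0) := by
    simp only [hFint]
    have := (ENNReal.continuous_ofReal.tendsto 0).comp
      ((tendsto_add_atTop_iff_nat 1).2 hsub)
    simpa [Function.comp_def] using this
  -- Taking the infimum avoids any measurability of `ε(θ)` or of the event in `hR`.
  have hzero : ∫⁻ θ, ⨅ H, F H θ ∂P.prior = 0 :=
    le_antisymm (ge_of_tendsto' hlim fun H => lintegral_mono fun θ => iInf_le _ H) zero_le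
  rw [lintegral_eq_zero_iff (Measurable.iInf hFm)] at hzero
  obtain ⟨θ, ⟨huniq, hent⟩, hθ⟩ := (hR.and_eventually hzero).exists
  obtain ⟨ε, hε, hround⟩ := P.exists_pos_le_roundRegret c hN huniq (hrate.trans_lt hent)
  refine hε.not_ge ?_
  refine le_of_le_of_eq (le_iInf fun H => ?_) hθ
  rw [hF, ENNReal.le_div_iff_mul_le (Or.inl (by simp)) (Or.inl (by simp)), mul_comm]
  exact P.le_lintegral_historyKernel c θ ε hround (H + 1)
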